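/- Let $\Lambda=\mathbb{R}[t^{\pm1}]$ and $\Omega=\mathbb{R}(t)$, both with the involution $\overline{p(t)}=p(t^{-1})$. A Blanchfield form over $\Lambda$ is a form $\lambda\colon H\times H\to\Omega/\Lambda$ on a finitely generated torsion $\Lambda$-module $H$ which is $\Lambda$-linear in the second variable, hermitian, i.e. $\lambda(a,b)=\overline{\lambda(b,a)}$, and non-singular, i.e. $a\mapsto\lambda(a,\cdot)$ is an isomorphism $H\to\overline{\operatorname{Hom}_\Lambda(H,\Omega/\Lambda)}$. For a hermitian $n\times n$ matrix $A$ over $\Lambda$ with $\det A\neq0$ let $\lambda(A)$ be the form $(a,b)\mapsto\overline{a}^{\,t}A^{-1}b$ on $\Lambda^n/A\Lambda^n$. A form is called diagonalizable if it is isometric to $\lambda(D)$ for some diagonal hermitian matrix $D$ over $\Lambda$ with $\det D\ne0$. **Proposition.** Let $\lambda\colon H\times H\to\Omega/\Lambda$ be a Blanchfield form over $\Lambda$ such that multiplication by $t+1$ and multiplication by $t-1$ are isomorphisms of $H$. Then $\lambda$ is diagonalizable. In particular, the real Blanchfield form of any knot, in its description by Seifert matrices, is diagonalizable: let $V$ be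 an integral $2g\times2g$ matrix with $V-V^t=\begin{pmatrix}0&I_g\\-I_g&0\end{pmatrix}$ (every knot has such a Seifert matrix). Then the matrix $$A(t)=\begin{pmatrix}(1-t^{-1})^{-1}I_g&0\\0&I_g\end{pmatrix}V\begin{pmatrix}I_g&0\\0&(1-t)I_g\end{pmatrix}+\begin{pmatrix}I_g&0\\0&(1-t^{-1})I_g\end{pmatrix}V^t\begin{pmatrix}(1-t)^{-1}I_g&0\\0&I_g\end{pmatrix}$$ has entries in $\Lambda$, is hermitian and has non-zero determinant, and the form $\lambda(A(t))$ (which represents the real Blanchfield form of a knot with Seifert matrix $V$) is a Blanchfield form and is diagonalizable. -/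

import Mathlib

noncomputable section

namespace Blanchfield

open scoped LaurentPolynomial Matrix

/-- The ring `Λ = ℝ[t, t⁻¹]`; the variable `t` is `LaurentPolynomial.T 1`. -/
abbrev Lam : Type := ℝ[T;T⁻¹]

/-- The quotient field `Ω = ℝ(t)` of `Λ`. -/
abbrev Om : Type := FractionRing Lam

/-- The involution `p(t) ↦ p(t⁻¹)` of `Λ`. -/
def bar : Lam →+* Lam := (LaurentPolynomial.invert (R := ℝ)).toRingEquiv.toRingHom

theorem bar_injective : Function.Injective bar :=
  (LaurentPolynomial.invert (R := ℝ)).injective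

/-- The extension of the involution to the quotient field `Ω`. -/
def barOm : Om →+* Om :=
  IsFractionRing.map (A := Lam) (B := Lam) (K := Om) (L := Om) (j := bar) bar_injective

theorem barOm_algebraMap (p : Lam) :
    barOm (algebraMap Lam Om p) = algebraMap Lam Om (bar p) :=
  IsLocalization.map_eq (M := nonZeroDivisors Lam) (T := nonZeroDivisors Lam)
    (nonZeroDivisors_le_comap_nonZeroDivisors_of_injective bar bar_injective) p

/-- `Λ`, as a `Λ`-submodule of `Ω`. -/
abbrev lamInOm : Submodule Lam Om := LinearMap.range (Algebra.linearMap Lam Om)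

/-- The `Λ`-module `Ω/Λ`. -/
abbrev QL : Type := Om ⧸ lamInOm

/-- The involution of `Ω` as a semilinear map. -/
def barOmₛₗ : Om →ₛₗ[bar] Om where
  toFun := barOm
  map_add' := map_add barOm
  map_smul' p x := by
    rw [Algebra.smul_def, Algebra.smul_def, map_mul, barOm_algebraMap]

/-- The involution induced on `Ω/Λ`. -/
def barQL : QL →ₛₗ[bar] QL :=
  Submodule.mapQ lamInOm lamInOm barOmₛₗ (by
    rintro _ ⟨p, rfl⟩
    exact ⟨bar p, (barOm_algebraMap p).symm⟩)

/-- `Ω/Λ`-valued forms on a `Λ`-module `H`: additive in both variables, `Λ`-linear in the second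
and `Λ`-semilinear with respect to the involution in the first variable. -/
abbrev Form (H : Type*) [AddCommGroup H] [Module Lam H] : Type _ :=
  H →ₛₗ[bar] H →ₗ[Lam] QL

/-- Blanchfield forms over `Λ`: hermitian non-singular forms with values in `Ω/Λ` on finitely
generated torsion `Λ`-modules. Non-singular means that `a ↦ φ(a, ·)` is bijective onto the
homomorphisms `H → Ω/Λ`; it is automatically linear for the involuted structure on the target. -/
structure IsBlanchfieldForm {H : Type*} [AddCommGroup H] [Module Lam H] (φ : Form H) : Prop where
  finite : Module.Finite Lam H
  torsion : Module.IsTorsion Lam H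
  hermitian : ∀ a b : H, φ a b = barQL (φ b a)
  nonsingular : Function.Bijective φ

/-- Two forms are isometric if a `Λ`-linear isomorphism carries one to the other. -/
def Isometric {H H' : Type*} [AddCommGroup H] [Module Lam H] [AddCommGroup H'] [Module Lam H']
    (φ : Form H) (ψ : Form H') : Prop :=
  ∃ e : H ≃ₗ[Lam] H', ∀ a b : H, ψ (e a) (e b) = φ a b

section MatrixForm

/-- A matrix over `Λ` is hermitian if it equals its transpose with the involution applied to
all entries. -/
def IsHermitianMatrix {n : Type*} (A : Matrix n n Lam) : Prop :=
  A.transpose.map bar = A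

/-- The image of a matrix over `Λ` in the matrices over `Ω`. -/
abbrev toOm {m k : Type*} (A : Matrix m k Lam) : Matrix m k Om :=
  A.map (algebraMap Lam Om)

/-- The image of a vector over `Λ` in the vectors over `Ω`. -/
def vecOm {n : Type*} : (n → Lam) →ₗ[Lam] (n → Om) :=
  LinearMap.compLeft (Algebra.linearMap Lam Om) n

/-- The entrywise involution on vectors over `Λ`. -/
def barVec {n : Type*} (a : n → Lam) : n → Lam := fun i => bar (a i)

/-- The sesquilinear map `(a, b) ↦ āᵗ A⁻¹ b ∈ Ω` on column vectors over `Λ`. -/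
def vecForm {n : Type*} [Fintype n] [DecidableEq n] (A : Matrix n n Lam) : (n → Lam) →ₛₗ[bar] (n → Lam) →ₗ[Lam] Om :=
  LinearMap.mk₂'ₛₗ bar (RingHom.id Lam)
    (fun a b => vecOm (barVec a) ⬝ᵥ ((toOm A)⁻¹ *ᵥ vecOm b))
    (fun a a' b => by
      have h : barVec (a + a') = barVec a + barVec a' := by ext1 i; simp [barVec]
      rw [h, map_add, add_dotProduct])
    (fun c a b => by
      have h : barVec (c • a) = bar c • barVec a := by ext1 i; simp [barVec]
      rw [h, map_smul, smul_dotProduct])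
    (fun a b b' => by rw [map_add, Matrix.mulVec_add, dotProduct_add])
    (fun c a b => by
      rw [map_smul, Matrix.mulVec_smul, dotProduct_smul, RingHom.id_apply])

theorem vecForm_apply {n : Type*} [Fintype n] [DecidableEq n] (A : Matrix n n Lam) (a b : n → Lam) :
    vecForm A a b = vecOm (barVec a) ⬝ᵥ ((toOm A)⁻¹ *ᵥ vecOm b) := rfl

theorem vecOm_mulVec {n : Type*} [Fintype n] (A : Matrix n n Lam) (b : n → Lam) :
    vecOm (A *ᵥ b) = toOm A *ᵥ vecOm b := by
  ext1 i
  exact RingHom.map_mulVec (algebraMap Lam Om) A b i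

theorem vecOm_dotProduct {n : Type*} [Fintype n] (a b : n → Lam) :
    vecOm a ⬝ᵥ vecOm b = algebraMap Lam Om (a ⬝ᵥ b) :=
  (RingHom.map_dotProduct (algebraMap Lam Om) a b).symm

theorem isUnit_det_toOm {n : Type*} [Fintype n] [DecidableEq n] {A : Matrix n n Lam} (hdet : A.det ≠ 0) : IsUnit (toOm A).det := by
  have h : (toOm A).det = algebraMap Lam Om A.det := (RingHom.map_det (algebraMap Lam Om) A).symm
  rw [h, isUnit_iff_ne_zero]
  exact fun h0 => hdet ((IsFractionRing.injective Lam Om) (by rw [h0, map_zero]))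

theorem vecForm_mulVec_right {n : Type*} [Fintype n] [DecidableEq n] {A : Matrix n n Lam} (hdet : A.det ≠ 0) (a c : n → Lam) :
    vecForm A a (A *ᵥ c) ∈ lamInOm := by
  rw [vecForm_apply, vecOm_mulVec, Matrix.mulVec_mulVec,
    Matrix.nonsing_inv_mul _ (isUnit_det_toOm hdet), Matrix.one_mulVec, vecOm_dotProduct]
  exact ⟨_, rfl⟩

theorem vecForm_mulVec_left {n : Type*} [Fintype n] [DecidableEq n] {A : Matrix n n Lam} (hA : IsHermitianMatrix A) (hdet : A.det ≠ 0)
    (c b : n → Lam) : vecForm A (A *ᵥ c) b ∈ lamInOm := by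
  have h : barVec (A *ᵥ c) = barVec c ᵥ* A := by
    conv_rhs => rw [← hA]
    ext1 i
    simp [barVec, Matrix.mulVec, Matrix.vecMul, dotProduct, mul_comm]
  have h' : vecOm (barVec c ᵥ* A) = vecOm (barVec c) ᵥ* toOm A := by
    ext1 i
    exact RingHom.map_vecMul (algebraMap Lam Om) A (barVec c) i
  rw [vecForm_apply, h, h', ← Matrix.dotProduct_mulVec, Matrix.mulVec_mulVec,
    Matrix.mul_nonsing_inv _ (isUnit_det_toOm hdet), Matrix.one_mulVec, vecOm_dotProduct]
  exact ⟨_, rfl⟩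

/-- The module `Λⁿ / A Λⁿ`. -/
abbrev Coker {n : Type*} [Fintype n] (A : Matrix n n Lam) : Type _ := (n → Lam) ⧸ LinearMap.range A.mulVecLin

/-- The form `(a, b) ↦ āᵗ A⁻¹ b ∈ Ω/Λ` on `Λⁿ / A Λⁿ`, for a hermitian matrix `A` over `Λ` with
non-zero determinant. -/
def matrixForm {n : Type*} [Fintype n] [DecidableEq n] (A : Matrix n n Lam) (hA : IsHermitianMatrix A) (hdet : A.det ≠ 0) :
    Form (Coker A) :=
  Submodule.liftQ (LinearMap.range A.mulVecLin)
    { toFun := fun a =>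
        Submodule.liftQ (LinearMap.range A.mulVecLin) (lamInOm.mkQ ∘ₗ vecForm A a) (by
          rintro _ ⟨c, rfl⟩
          exact (Submodule.Quotient.mk_eq_zero _).2 (vecForm_mulVec_right hdet a c))
      map_add' := fun a a' => by
        refine Submodule.linearMap_qext _ (LinearMap.ext fun b => ?_)
        change lamInOm.mkQ (vecForm A (a + a') b) =
          lamInOm.mkQ (vecForm A a b) + lamInOm.mkQ (vecForm A a' b)
        rw [map_add, LinearMap.add_apply, map_add]
      map_smul' := fun c a => by
        refine Submodule.linearMap_qext _ (LinearMap.ext fun b => ?_)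
        change lamInOm.mkQ (vecForm A (c • a) b) = bar c • lamInOm.mkQ (vecForm A a b)
        rw [LinearMap.map_smulₛₗ, LinearMap.smul_apply, map_smul] }
    (by
      rintro _ ⟨c, rfl⟩
      refine Submodule.linearMap_qext _ (LinearMap.ext fun b => ?_)
      exact (Submodule.Quotient.mk_eq_zero _).2 (vecForm_mulVec_left hA hdet c b))

theorem matrixForm_mk {n : Type*} [Fintype n] [DecidableEq n] (A : Matrix n n Lam) (hA : IsHermitianMatrix A) (hdet : A.det ≠ 0)
    (a b : n → Lam) :
    matrixForm A hA hdet (Submodule.Quotient.mk a) (Submodule.Quotient.mk b) =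
      Submodule.Quotient.mk (vecOm (barVec a) ⬝ᵥ ((toOm A)⁻¹ *ᵥ vecOm b)) := rfl

end MatrixForm

/-- A form is diagonalizable if it is isometric to the form of a diagonal hermitian matrix over `Λ`
with non-zero determinant. -/
def IsDiagonalizable {H : Type*} [AddCommGroup H] [Module Lam H] (φ : Form H) : Prop :=
  ∃ (n : ℕ) (D : Matrix (Fin n) (Fin n) Lam) (hD : IsHermitianMatrix D) (hdet : D.det ≠ 0),
    D.IsDiag ∧ Isometric (matrixForm D hD hdet) φ

/-- The variable `t` as an element of `Ω`. -/
def tOm : Om := algebraMap Lam Om (LaurentPolynomial.T 1)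

/-- The matrix `A(t)` of a Seifert matrix `V` of size `2g`, in `g × g` blocks:
`diag((1 - t⁻¹)⁻¹, 1) V diag(1, 1 - t) + diag(1, 1 - t⁻¹) Vᵗ diag((1 - t)⁻¹, 1)`.
It is a priori a matrix over `Ω`. -/
def seifertToBlanchfield {g : ℕ} (V : Matrix (Fin g ⊕ Fin g) (Fin g ⊕ Fin g) ℤ) :
    Matrix (Fin g ⊕ Fin g) (Fin g ⊕ Fin g) Om :=
  Matrix.fromBlocks ((1 - tOm⁻¹)⁻¹ • 1) 0 0 1 * V.map (Int.cast : ℤ → Om) *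
      Matrix.fromBlocks 1 0 0 ((1 - tOm) • 1) +
    Matrix.fromBlocks 1 0 0 ((1 - tOm⁻¹) • 1) * (V.map (Int.cast : ℤ → Om)).transpose *
      Matrix.fromBlocks ((1 - tOm)⁻¹ • 1) 0 0 1

end Blanchfield

end

/-! ### Fractions in `Ω/Λ`, symmetric Laurent polynomials, square roots modulo prime powers. -/

noncomputable section

namespace Blanchfield

open LaurentPolynomial (T)

/-! The form is diagonalized by Gram–Schmidt. Elements `y i` that are pairwise orthogonal, with `φ
(y i) (y i) = 1 / D i` and `D i` symmetric and annihilating `y i`, span an orthogonal summand. By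
noetherianity some such span is maximal. If it is not all of `H`, its orthogonal complement `N` is
non-zero and non-degenerate, and `exists_splitting_element` finds a further element in `N`.

To find it, work over the fixed ring of the involution, the image of the PID `ℝ[X]` under `X ↦ t +
t⁻¹`. Let `f = q^(k+1) e` generate the symmetric annihilator of `N`, with `q` irreducible and prime
to `e`. Since `t² - 1` acts injectively, polarization yields `x` in `N` whose value `φ x x` retains
the full power of `q` in its denominator, so `φ (e x) (e x) = g / q^(k+1)` with `q` not dividing
`g`. The residue field `ℝ[X]/q` is `ℝ` or `ℂ`, so `g⁻¹` is a square up to sign there and, by Hensel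
lifting, modulo `q^(k+1)`. Rescaling `e x` by the root turns the numerator into `±1`.

For a Seifert matrix the poles of `A(t)` cancel. Its determinant is a unit at `t = 1` and an odd
integer at `t = -1`. As it annihilates the cokernel, `t - 1` and `t + 1` act injectively. -/

theorem bar_T (n : ℤ) : bar (T n) = T (-n) := LaurentPolynomial.invert_T n

theorem bar_C (r : ℝ) : bar (LaurentPolynomial.C r) = LaurentPolynomial.C r :=
  LaurentPolynomial.invert_C r

theorem bar_bar (p : Lam) : bar (bar p) = p := LaurentPolynomial.involutive_invert p

instance : IsNoetherianRing Lam :=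
  IsLocalization.isNoetherianRing (Submonoid.powers (Polynomial.X : Polynomial ℝ)) Lam
    inferInstance

/-- The class of the fraction `r / d` in `Ω/Λ`. -/
def frac (r d : Lam) : QL :=
  Submodule.Quotient.mk (algebraMap Lam Om r / algebraMap Lam Om d)

theorem smul_frac (c r d : Lam) : c • frac r d = frac (c * r) d := by
  unfold frac
  rw [← Submodule.Quotient.mk_smul, Algebra.smul_def, map_mul, mul_div_assoc]

theorem frac_add (r s d : Lam) : frac r d + frac s d = frac (r + s) d := by
  unfold frac
  rw [← Submodule.Quotient.mk_add, map_add, add_div]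

theorem algebraMap_ne_zero {d : Lam} (hd : d ≠ 0) : algebraMap Lam Om d ≠ 0 :=
  (map_ne_zero_iff _ (IsFractionRing.injective Lam Om)).2 hd

theorem frac_eq_zero_iff {d : Lam} (hd : d ≠ 0) (r : Lam) : frac r d = 0 ↔ d ∣ r := by
  have hd' := algebraMap_ne_zero hd
  unfold frac
  rw [Submodule.Quotient.mk_eq_zero]
  constructor
  · rintro ⟨c, hc⟩
    refine ⟨c, IsFractionRing.injective Lam Om ?_⟩
    rw [map_mul, ← Algebra.linearMap_apply, ← Algebra.linearMap_apply, ← Algebra.linearMap_apply,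
      hc, Algebra.linearMap_apply, Algebra.linearMap_apply]
    field_simp
  · rintro ⟨c, rfl⟩
    refine ⟨c, ?_⟩
    rw [Algebra.linearMap_apply, map_mul]
    field_simp

theorem exists_eq_frac {d : Lam} (hd : d ≠ 0) {x : QL} (hx : d • x = 0) : ∃ r, x = frac r d := by
  have hd' := algebraMap_ne_zero hd
  obtain ⟨x, rfl⟩ := Submodule.Quotient.mk_surjective _ x
  rw [← Submodule.Quotient.mk_smul, Submodule.Quotient.mk_eq_zero] at hx
  obtain ⟨r, hr⟩ := hx
  refine ⟨r, ?_⟩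
  unfold frac
  rw [← Algebra.linearMap_apply, hr, Algebra.smul_def, mul_div_cancel_left₀ _ hd']

theorem barQL_frac (r d : Lam) : barQL (frac r d) = frac (bar r) (bar d) := by
  change Submodule.Quotient.mk (barOm _) = _
  rw [map_div₀, barOm_algebraMap, barOm_algebraMap]
  rfl

/-- Substitution of `t + t⁻¹` into real polynomials. -/
def symEval : Polynomial ℝ →ₐ[ℝ] Lam := Polynomial.aeval (T 1 + T (-1))

theorem bar_symEval (f : Polynomial ℝ) : bar (symEval f) = symEval f := by
  have h : (LaurentPolynomial.invert (R := ℝ)).toAlgHom.comp symEval = symEval := by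
    refine Polynomial.algHom_ext ?_
    simp [symEval, add_comm]
  exact DFunLike.congr_fun h f

/-- Chebyshev recursion: the product of `t + t⁻¹` with the `(n+1)`-st sum is the `(n+2)`-nd plus the
`n`-th. -/
theorem T_add_T_neg_mem_range (n : ℕ) : (T (n : ℤ) + T (-(n : ℤ)) : Lam) ∈ symEval.range := by
  induction n using Nat.twoStepInduction with
  | zero => exact ⟨2, by simp [one_add_one_eq_two, map_ofNat]⟩
  | one => exact ⟨Polynomial.X, by simp [symEval]⟩
  | more n h0 h1 =>
    have hX : (T 1 + T (-1) : Lam) ∈ symEval.range := ⟨Polynomial.X, by simp [symEval]⟩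
    have h := sub_mem (mul_mem hX h1) h0
    convert h using 1
    simp only [add_mul, mul_add, ← LaurentPolynomial.T_add]
    push_cast
    ring_nf

theorem add_bar_mem_range (w : Lam) : w + bar w ∈ symEval.range := by
  induction w using LaurentPolynomial.induction_on' with
  | add p q hp hq =>
    rw [map_add, add_add_add_comm]
    exact add_mem hp hq
  | C_mul_T n a =>
    rw [map_mul, bar_C, bar_T, ← mul_add]
    refine mul_mem (symEval.range.algebraMap_mem a) ?_
    obtain ⟨m, rfl | rfl⟩ := n.eq_nat_or_neg
    · exact T_add_T_neg_mem_range m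
    · rw [neg_neg, add_comm]
      exact T_add_T_neg_mem_range m

theorem exists_symEval_eq {w : Lam} (hw : bar w = w) : ∃ g, symEval g = w := by
  have h := symEval.range.smul_mem (add_bar_mem_range w) (1 / 2 : ℝ)
  rwa [hw, ← two_smul ℝ w, smul_smul, one_div, inv_mul_cancel₀ two_ne_zero, one_smul] at h

/-- An algebraic extension of `ℝ` is `ℝ` or `ℂ`. A sign is needed only in the first case. -/
theorem exists_sq_eq_or_neg {K : Type*} [Field K] [Algebra ℝ K] [Algebra.IsAlgebraic ℝ K] (a : K) :
    ∃ b : K, b ^ 2 = a ∨ b ^ 2 = -a := by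
  obtain ⟨⟨e⟩⟩ | ⟨⟨e⟩⟩ := Real.nonempty_algEquiv_or K
  · obtain ⟨b, hb⟩ : ∃ b : ℝ, b ^ 2 = e a ∨ b ^ 2 = -e a := by
      obtain h | h := le_total 0 (e a)
      · exact ⟨_, Or.inl (Real.sq_sqrt h)⟩
      · exact ⟨_, Or.inr (Real.sq_sqrt (neg_nonneg.2 h))⟩
    refine ⟨e.symm b, ?_⟩
    rw [← map_pow]
    refine hb.imp (fun h => ?_) (fun h => ?_)
    · rw [h, e.symm_apply_apply]
    · rw [h, map_neg, e.symm_apply_apply]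
  · obtain ⟨b, hb⟩ := IsAlgClosed.exists_pow_nat_eq (e a) two_pos
    exact ⟨e.symm b, Or.inl (by rw [← map_pow, hb]; simp)⟩

open Polynomial in
/-- Modulo a power of an irreducible real polynomial `q`, a polynomial prime to `q` is the inverse
of a square up to sign. -/
theorem exists_pow_dvd_sq_mul_sub {q g : ℝ[X]} (hq : Irreducible q) (hg : ¬ q ∣ g) (k : ℕ) :
    ∃ v ε : ℝ[X], (ε = 1 ∨ ε = -1) ∧ q ^ k ∣ v ^ 2 * g - ε := by
  obtain ⟨v, ε, hε, hv⟩ : ∃ v ε : ℝ[X], (ε = 1 ∨ ε = -1) ∧ q ∣ v ^ 2 * g - ε := by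
    have : Fact (Irreducible q) := ⟨hq⟩
    have : FiniteDimensional ℝ (AdjoinRoot q) := (AdjoinRoot.powerBasis hq.ne_zero).finite
    have hg' : AdjoinRoot.mk q g ≠ 0 := fun h => hg (AdjoinRoot.mk_eq_zero.1 h)
    obtain ⟨b, hb⟩ := exists_sq_eq_or_neg (AdjoinRoot.mk q g)⁻¹
    obtain ⟨v, rfl⟩ := AdjoinRoot.mk_surjective b
    obtain hb | hb := hb
    · refine ⟨v, 1, Or.inl rfl, AdjoinRoot.mk_eq_zero.1 ?_⟩
      rw [map_sub, map_mul, map_pow, hb, inv_mul_cancel₀ hg', map_one, sub_self]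
    · refine ⟨v, -1, Or.inr rfl, AdjoinRoot.mk_eq_zero.1 ?_⟩
      rw [map_sub, map_mul, map_pow, hb, neg_mul, inv_mul_cancel₀ hg', map_neg, map_one, sub_self]
  have hε1 : ε * ε = 1 := by obtain rfl | rfl := hε <;> ring
  let I : Ideal ℝ[X] := Ideal.span {q ^ k}
  -- `v` is a root of `g X² - ε` modulo `q`, hence up to a nilpotent modulo `q^k`. It lifts by
  -- Newton's method once the derivative `2 g v` is a unit.
  let P : (ℝ[X])[X] := C g * X ^ 2 - C ε
  have hP (w : ℝ[X]) : aeval (Ideal.Quotient.mk I w) P = Ideal.Quotient.mk I (w ^ 2 * g - ε) := by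
    rw [map_sub, map_mul, map_pow, aeval_C, aeval_C, aeval_X, Ideal.Quotient.algebraMap_eq, map_sub,
      map_mul, map_pow, mul_comm]
  have hnil : IsNilpotent (aeval (Ideal.Quotient.mk I v) P) := by
    refine ⟨k, ?_⟩
    rw [hP, ← map_pow]
    exact Ideal.Quotient.eq_zero_iff_mem.2 (Ideal.mem_span_singleton.2 (pow_dvd_pow_of_dvd hv k))
  have hunit : IsUnit (aeval (Ideal.Quotient.mk I v) (derivative P)) := by
    have hc : IsCoprime (g * (2 * v)) (q ^ k) := by
      refine IsCoprime.pow_right ?_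
      obtain ⟨c, hc⟩ := hv
      -- Because `g v² ≡ ε` modulo `q`, the inverse of `2 g v` there is `ε v / 2`.
      refine ⟨ε * v * C (1 / 2), -ε * c, ?_⟩
      have h2 : (C (1 / 2) * 2 : ℝ[X]) = 1 := by
        rw [← C_ofNat, ← C_mul]; norm_num
      linear_combination (ε * v ^ 2 * g) * h2 + ε * hc + hε1
    obtain ⟨a, b, hab⟩ := hc
    have h : aeval (Ideal.Quotient.mk I v) (derivative P) =
        Ideal.Quotient.mk I (g * (2 * v)) := by
      simp [P, Ideal.Quotient.algebraMap_eq, one_add_one_eq_two, map_ofNat]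
    rw [h]
    refine IsUnit.of_mul_eq_one_right (Ideal.Quotient.mk I a) ?_
    rw [← map_mul, ← map_one (Ideal.Quotient.mk I)]
    refine Ideal.Quotient.eq.2 (Ideal.mem_span_singleton.2 ⟨-b, ?_⟩)
    linear_combination hab
  obtain ⟨r, ⟨-, hr⟩, -⟩ := existsUnique_nilpotent_sub_and_aeval_eq_zero hnil hunit
  obtain ⟨w, rfl⟩ := Ideal.Quotient.mk_surjective r
  rw [hP] at hr
  exact ⟨w, ε, hε, Ideal.mem_span_singleton.1 (Ideal.Quotient.eq_zero_iff_mem.1 hr)⟩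

end Blanchfield
end

/-! ### Orthogonal families and the diagonalization of Blanchfield forms. -/

noncomputable section

namespace Blanchfield

open LaurentPolynomial (T)

variable {H : Type*} [AddCommGroup H] [Module Lam H] {φ : Form H}

theorem Form.smul_smul_apply (φ : Form H) (c d : Lam) (x y : H) :
    φ (c • x) (d • y) = (bar c * d) • φ x y := by
  rw [map_smul, LinearMap.map_smulₛₗ, LinearMap.smul_apply, smul_smul, mul_comm]

/-- Polarization: the values of a form are determined by its values on the diagonal as soon as
`t² - 1` is invertible. -/
theorem smul_apply_eq_zero_of_diagonal {N : Submodule Lam H} {c : Lam}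
    (h : ∀ x ∈ N, c • φ x x = 0) {x y : H} (hx : x ∈ N) (hy : y ∈ N) :
    ((T 1 + 1) * ((T 1 - 1) * c)) • φ x y = 0 := by
  have hxy (z : H) (hz : z ∈ N) : c • φ x z + c • φ z x = 0 := by
    have := h _ (N.add_mem hx hz)
    rw [map_add φ, LinearMap.add_apply, map_add, map_add, smul_add, smul_add, smul_add, h x hx,
      h z hz] at this
    simpa using this
  -- Polarizing with `y` and with `t y` gives two relations between `φ x y` and `φ y x`. Subtracting
  -- the first from `t` times the second eliminates `φ y x` and leaves the factor `t² - 1`.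
  have h1 := hxy y hy
  have h2 := hxy _ (N.smul_mem (T 1) hy)
  rw [map_smul, LinearMap.map_smulₛₗ, LinearMap.smul_apply, bar_T] at h2
  have hT : (T 1 * T (-1) : Lam) = 1 := by rw [← LaurentPolynomial.T_add]; simp
  have key : (T 1 + 1) * ((T 1 - 1) * c) = T 1 * (c * T 1) - c := by ring
  have key2 : T 1 * (c * T (-1)) = c := by linear_combination c * hT
  have h3 : (T 1 : Lam) • (c • (T 1 : Lam) • φ x y + c • (T (-1) : Lam) • φ y x) = 0 := by
    rw [h2, smul_zero]
  simp only [smul_add, smul_smul, key2] at h3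
  rw [key, sub_smul, ← sub_eq_zero.2 (h3.trans h1.symm)]
  abel

/-- An orthogonal family of elements of `H` such that the form takes the value `1 / D i` on the
`i`-th element, where `D i` is symmetric and annihilates this element. -/
structure IsOrthFamily (φ : Form H) {n : ℕ} (y : Fin n → H) (D : Fin n → Lam) : Prop where
  bar_eq : ∀ i, bar (D i) = D i
  ne_zero : ∀ i, D i ≠ 0
  smul_eq_zero : ∀ i, D i • y i = 0
  self : ∀ i, φ (y i) (y i) = frac 1 (D i)
  orth : ∀ i j, i ≠ j → φ (y i) (y j) = 0

theorem IsOrthFamily.apply_sum {n : ℕ} {y : Fin n → H} {D : Fin n → Lam}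
    (h : IsOrthFamily φ y D) (c : Fin n → Lam) (i : Fin n) :
    φ (y i) (∑ j, c j • y j) = frac (c i) (D i) := by
  rw [map_sum, Finset.sum_eq_single i (fun j _ hj => by rw [map_smul, h.orth i j hj.symm, smul_zero])
    (by simp), map_smul, h.self, smul_frac, mul_one]

theorem IsOrthFamily.sum_apply_sum {n : ℕ} {y : Fin n → H} {D : Fin n → Lam}
    (h : IsOrthFamily φ y D) (a b : Fin n → Lam) :
    φ (∑ i, a i • y i) (∑ j, b j • y j) = ∑ i, frac (bar (a i) * b i) (D i) := by
  rw [map_sum φ, LinearMap.sum_apply]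
  refine Finset.sum_congr rfl fun i _ => ?_
  rw [LinearMap.map_smulₛₗ, LinearMap.smul_apply, h.apply_sum, smul_frac]

/-- Pairing with `y i` recovers `c i` modulo `D i`, so the span is the direct sum of the modules `Λ
/ D i`. -/
theorem IsOrthFamily.sum_eq_zero_iff {n : ℕ} {y : Fin n → H} {D : Fin n → Lam}
    (h : IsOrthFamily φ y D) (c : Fin n → Lam) : ∑ j, c j • y j = 0 ↔ ∀ i, D i ∣ c i := by
  constructor
  · intro hc i
    rw [← frac_eq_zero_iff (h.ne_zero i), ← h.apply_sum, hc, map_zero]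
  · intro hc
    refine Finset.sum_eq_zero fun i _ => ?_
    obtain ⟨d, hd⟩ := hc i
    rw [hd, mul_comm, mul_smul, h.smul_eq_zero, smul_zero]

/-- Orthogonal projection to the span: `φ (y i) z` is killed by `D i`, hence equals some `r i / D
i`, and `∑ r i • y i` has the same pairings as `z`. -/
theorem IsOrthFamily.exists_sub_orth {n : ℕ} {y : Fin n → H} {D : Fin n → Lam}
    (h : IsOrthFamily φ y D) (z : H) :
    ∃ m ∈ Submodule.span Lam (Set.range y), ∀ i, φ (y i) (z - m) = 0 := by
  have hz (i : Fin n) : ∃ r, φ (y i) z = frac r (D i) := by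
    refine exists_eq_frac (h.ne_zero i) ?_
    rw [← h.bar_eq i, ← LinearMap.smul_apply, ← LinearMap.map_smulₛₗ, h.smul_eq_zero, map_zero,
      LinearMap.zero_apply]
  choose r hr using hz
  refine ⟨∑ j, r j • y j, ?_, fun i => ?_⟩
  · exact Submodule.sum_mem _ fun j _ => Submodule.smul_mem _ _ (Submodule.subset_span ⟨j, rfl⟩)
  · rw [map_sub, h.apply_sum, hr, sub_self]

theorem IsOrthFamily.snoc {n : ℕ} {y : Fin n → H} {D : Fin n → Lam} (h : IsOrthFamily φ y D)
    (hφ : ∀ a b, φ a b = barQL (φ b a)) {z : H} {d : Lam} (hbar : bar d = d) (hd : d ≠ 0)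
    (hz : d • z = 0) (hzz : φ z z = frac 1 d) (hyz : ∀ i, φ (y i) z = 0) :
    IsOrthFamily φ (Fin.snoc y z : Fin (n + 1) → H) (Fin.snoc D d : Fin (n + 1) → Lam) where
  bar_eq i := by
    refine Fin.lastCases ?_ (fun i => ?_) i <;> simp [hbar, h.bar_eq]
  ne_zero i := by
    refine Fin.lastCases ?_ (fun i => ?_) i <;> simp [hd, h.ne_zero]
  smul_eq_zero i := by
    refine Fin.lastCases ?_ (fun i => ?_) i <;> simp [hz, h.smul_eq_zero]
  self i := by
    refine Fin.lastCases ?_ (fun i => ?_) i <;> simp [hzz, h.self]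
  orth i j := by
    refine Fin.lastCases ?_ (fun i => ?_) i <;> refine Fin.lastCases ?_ (fun j => ?_) j
    · simp
    · intro _
      rw [hφ]
      simp [hyz]
    · simp [hyz]
    · intro hij
      simpa using h.orth i j (fun h => hij (by rw [h]))

theorem IsOrthFamily.isDiagonalizable {n : ℕ} {y : Fin n → H} {D : Fin n → Lam}
    (h : IsOrthFamily φ y D) (hy : Submodule.span Lam (Set.range y) = ⊤) : IsDiagonalizable φ := by
  have hD : IsHermitianMatrix (Matrix.diagonal D) := by
    rw [IsHermitianMatrix, Matrix.diagonal_transpose, Matrix.diagonal_map (map_zero bar)]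
    exact congrArg _ (funext h.bar_eq)
  have hdet : (Matrix.diagonal D).det ≠ 0 := by
    rw [Matrix.det_diagonal]
    exact Finset.prod_ne_zero_iff.2 fun i _ => h.ne_zero i
  let f : (Fin n → Lam) →ₗ[Lam] H := Fintype.linearCombination Lam y
  have hf (c : Fin n → Lam) : f c = ∑ i, c i • y i := rfl
  have hsurj : Function.Surjective f := by
    rw [← LinearMap.range_eq_top, ← hy]
    exact Fintype.range_linearCombination Lam y
  have hker : LinearMap.range (Matrix.diagonal D).mulVecLin = LinearMap.ker f := by
    ext c
    rw [LinearMap.mem_ker, hf, h.sum_eq_zero_iff]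
    constructor
    · rintro ⟨b, rfl⟩ i
      exact ⟨b i, Matrix.mulVec_diagonal D b i⟩
    · intro hc
      choose b hb using hc
      exact ⟨b, funext fun i => (Matrix.mulVec_diagonal D b i).trans (hb i).symm⟩
  refine ⟨n, Matrix.diagonal D, hD, hdet, Matrix.isDiag_diagonal D,
    (Submodule.quotEquivOfEq _ _ hker).trans (f.quotKerEquivOfSurjective hsurj), ?_⟩
  intro a b
  obtain ⟨a, rfl⟩ := Submodule.Quotient.mk_surjective _ a
  obtain ⟨b, rfl⟩ := Submodule.Quotient.mk_surjective _ b
  rw [matrixForm_mk]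
  change φ (f a) (f b) = _
  rw [hf, hf, h.sum_apply_sum]
  have hinv : (toOm (Matrix.diagonal D))⁻¹ =
      Matrix.diagonal fun i => (algebraMap Lam Om (D i))⁻¹ := by
    refine Matrix.inv_eq_right_inv ?_
    rw [toOm, Matrix.diagonal_map (map_zero _), Matrix.diagonal_mul_diagonal, ← Matrix.diagonal_one]
    exact congrArg _ (funext fun i => mul_inv_cancel₀ (algebraMap_ne_zero (h.ne_zero i)))
  rw [hinv, dotProduct, ← Submodule.mkQ_apply, map_sum]
  refine Finset.sum_congr rfl fun i _ => ?_
  rw [Matrix.mulVec_diagonal, Submodule.mkQ_apply]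
  unfold frac
  rw [map_mul, div_eq_mul_inv]
  refine congrArg _ ?_
  change _ = algebraMap Lam Om (bar (a i)) * (_ * algebraMap Lam Om (b i))
  ring

/-- A non-zero submodule on which the form is non-degenerate contains an element that spans a
non-zero orthogonal summand. -/
theorem exists_splitting_element {N : Submodule Lam H} (hφ : ∀ a b, φ a b = barQL (φ b a))
    (hN : N ≠ ⊥) (hnd : ∀ x ∈ N, (∀ z ∈ N, φ z x = 0) → x = 0)
    {a : Lam} (ha : a ≠ 0) (haN : ∀ x ∈ N, a • x = 0)
    (hadd : ∀ x : H, (T 1 + 1 : Lam) • x = 0 → x = 0)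
    (hsub : ∀ x : H, (T 1 - 1 : Lam) • x = 0 → x = 0) :
    ∃ y ∈ N, ∃ D : Lam, bar D = D ∧ D ≠ 0 ∧ D • y = 0 ∧ φ y y = frac 1 D ∧ φ y y ≠ 0 := by
  -- Only symmetric annihilators are considered, so that they form an ideal in `ℝ[X]` and pass
  -- through both variables of the form unchanged.
  let I : Ideal (Polynomial ℝ) := (N.annihilator).comap symEval.toRingHom
  have hI (f : Polynomial ℝ) : f ∈ I ↔ ∀ x ∈ N, symEval f • x = 0 := Submodule.mem_annihilator
  obtain ⟨f, hf⟩ := IsPrincipalIdealRing.principal I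
  have hIf (p : Polynomial ℝ) : p ∈ I ↔ f ∣ p := by
    rw [hf]
    exact Ideal.mem_span_singleton
  have hf0 : symEval f ≠ 0 := by
    -- The norm `a * bar a` is a non-zero symmetric annihilator.
    obtain ⟨p, hp⟩ := exists_symEval_eq (w := a * bar a) (by rw [map_mul, bar_bar, mul_comm])
    obtain ⟨r, rfl⟩ := (hIf p).1 ((hI p).2 fun x hx => by
      rw [hp, mul_comm, mul_smul, haN x hx, smul_zero])
    intro h0
    rw [map_mul, h0, zero_mul] at hp
    exact mul_ne_zero ha ((map_ne_zero_iff _ bar_injective).2 ha) hp.symm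
  have hfunit : ¬ IsUnit f := by
    intro hu
    refine hN ((Submodule.eq_bot_iff N).2 fun x hx => ?_)
    simpa using (hI 1).1 ((hIf 1).2 hu.dvd) x hx
  have hfne : f ≠ 0 := by
    rintro rfl
    exact hf0 (map_zero _)
  obtain ⟨q, hq, hqf⟩ := WfDvdMonoid.exists_irreducible_factor hfunit hfne
  obtain ⟨e, hfe, hqe⟩ := (FiniteMultiplicity.of_not_isUnit hq.not_isUnit hfne).exists_eq_pow_mul_and_not_dvd
  obtain ⟨k, hk⟩ : ∃ k, multiplicity q f = k + 1 := by
    refine Nat.exists_eq_succ_of_ne_zero fun h0 => ?_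
    rw [h0, pow_zero, one_mul] at hfe
    exact hqe (hfe ▸ hqf)
  rw [hk] at hfe
  -- an element on which the form has a denominator of maximal order at `q`
  obtain ⟨x, hx, hxx⟩ : ∃ x ∈ N, symEval (q ^ k * e ^ 2) • φ x x ≠ 0 := by
    by_contra! hcon
    -- Otherwise polarization and non-degeneracy make `q^k e²` annihilate `N`. Then `q^(k+1) e`
    -- divides it, and `q` divides `e`. The square appears because `φ (e x) (e x) = e² φ x x`.
    have hmem : q ^ k * e ^ 2 ∈ I := by
      refine (hI _).2 fun x hx => hsub _ (hadd _ ?_)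
      rw [smul_smul, smul_smul]
      refine hnd _ (N.smul_mem _ hx) fun z hz => ?_
      rw [map_smul, mul_assoc]
      exact smul_apply_eq_zero_of_diagonal hcon hz hx
    rw [hIf, hfe, pow_succ, mul_assoc, mul_dvd_mul_iff_left (pow_ne_zero _ hq.ne_zero)] at hmem
    exact hqe (hq.prime.dvd_of_dvd_pow (dvd_of_mul_right_dvd hmem))
  set Q : Lam := symEval (q ^ (k + 1)) with hQ
  have hQ0 : Q ≠ 0 := by
    intro h0
    rw [hfe, map_mul, ← hQ, h0, zero_mul] at hf0
    exact hf0 rfl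
  have hQbar : bar Q = Q := bar_symEval _
  set x' : H := symEval e • x with hx'
  have hx'N : x' ∈ N := N.smul_mem _ hx
  have hQx' : Q • x' = 0 := by
    rw [hx', smul_smul, hQ, ← map_mul, ← hfe]
    exact (hI f).1 ((hIf f).2 dvd_rfl) x hx
  have hφx' : φ x' x' = symEval (e ^ 2) • φ x x := by
    rw [hx', φ.smul_smul_apply, bar_symEval, ← map_mul, pow_two]
  obtain ⟨w, hw⟩ := exists_eq_frac hQ0 (x := φ x' x') (by rw [← map_smul, hQx', map_zero])
  obtain ⟨g, hg⟩ : ∃ g, φ x' x' = frac (symEval g) Q := by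
    -- By hermitian symmetry `w` and `bar w` are both numerators over `Q`, and so is their symmetric
    -- mean.
    have hw' : φ x' x' = frac (bar w) Q := by rw [hφ, hw, barQL_frac, hQbar]
    have hs : bar (LaurentPolynomial.C (1 / 2) * (w + bar w)) =
        LaurentPolynomial.C (1 / 2) * (w + bar w) := by
      rw [map_mul, map_add, bar_bar, bar_C, add_comm]
    obtain ⟨g, hg⟩ := exists_symEval_eq hs
    refine ⟨g, ?_⟩
    rw [hg, ← smul_frac, ← frac_add, ← hw, ← hw', ← two_smul Lam, smul_smul]
    have h2 : (LaurentPolynomial.C (1 / 2) * 2 : Lam) = 1 := by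
      rw [← map_ofNat LaurentPolynomial.C 2, ← map_mul]
      norm_num
    rw [h2, one_smul]
  have hqg : ¬ q ∣ g := by
    rintro ⟨r, rfl⟩
    refine hxx ?_
    rw [map_mul, mul_smul, ← hφx', hg, smul_frac, frac_eq_zero_iff hQ0, hQ, ← map_mul]
    exact map_dvd symEval ⟨r, by ring⟩
  obtain ⟨v, ε, hε, c, hc⟩ := exists_pow_dvd_sq_mul_sub hq hqg (k + 1)
  have hε1 : ε * ε = 1 := by obtain rfl | rfl := hε <;> ring
  have hε2 : symEval ε * symEval ε = 1 := by rw [← map_mul, hε1, map_one]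
  have hε0 : symEval ε ≠ 0 := left_ne_zero_of_mul_eq_one hε2
  have hφy : φ (symEval v • x') (symEval v • x') = frac (symEval (v ^ 2 * g)) Q := by
    rw [φ.smul_smul_apply, bar_symEval, hg, smul_frac, ← map_mul, ← map_mul, ← pow_two]
  refine ⟨symEval v • x', N.smul_mem _ hx'N, symEval ε * Q, ?_, mul_ne_zero hε0 hQ0, ?_, ?_, ?_⟩
  · rw [map_mul, bar_symEval, hQbar]
  · rw [smul_smul, mul_comm, ← mul_assoc, mul_smul, hQx', smul_zero]
  · have h1 : frac 1 (symEval ε * Q) = frac (symEval ε) Q := by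
      unfold frac
      have h := algebraMap_ne_zero hε0
      have h' := algebraMap_ne_zero hQ0
      have hε3 := congrArg (algebraMap Lam Om) hε2
      rw [map_mul, map_one] at hε3
      congr 1
      rw [map_mul, map_one, div_eq_div_iff (mul_ne_zero h h') h']
      linear_combination -algebraMap Lam Om Q * hε3
    have h2 : v ^ 2 * g = ε + q ^ (k + 1) * c := by linear_combination hc
    rw [hφy, h1, h2, map_add, ← frac_add, map_mul, ← hQ, add_eq_left, frac_eq_zero_iff hQ0]
    exact dvd_mul_right _ _
  · rw [hφy, Ne, frac_eq_zero_iff hQ0, sub_eq_iff_eq_add.1 hc, map_add, map_mul, ← hQ]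
    intro hdvd
    -- If the new value vanished, `Q` would divide `±1`, and every fraction over `Q` would be zero,
    -- against the choice of `x`.
    have h1 : Q ∣ 1 := by
      rw [← hε2]
      exact dvd_mul_of_dvd_left ((dvd_add_right (dvd_mul_right _ _)).1 hdvd) _
    refine hxx ?_
    rw [map_mul, mul_smul, ← hφx', hg, smul_frac, frac_eq_zero_iff hQ0]
    exact h1.trans (one_dvd _)

/-- A Blanchfield form is diagonalizable if `t + 1` and `t - 1` act injectively. -/
theorem IsBlanchfieldForm.isDiagonalizable (h : IsBlanchfieldForm φ)
    (hadd : ∀ x : H, (T 1 + 1 : Lam) • x = 0 → x = 0)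
    (hsub : ∀ x : H, (T 1 - 1 : Lam) • x = 0 → x = 0) : IsDiagonalizable φ := by
  have := h.finite
  obtain ⟨a, ha, ha0⟩ := Submodule.annihilator_top_inter_nonZeroDivisors h.torsion
  let s : Set (Submodule Lam H) :=
    {M | ∃ (n : ℕ) (y : Fin n → H) (D : Fin n → Lam), IsOrthFamily φ y D ∧
      Submodule.span Lam (Set.range y) = M}
  have hs : s.Nonempty :=
    ⟨_, 0, Fin.elim0, Fin.elim0, ⟨fun i => i.elim0, fun i => i.elim0, fun i => i.elim0,
      fun i => i.elim0, fun i => i.elim0⟩, rfl⟩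
  obtain ⟨M, ⟨n, y, D, hy, rfl⟩, hmax⟩ := set_has_maximal_iff_noetherian.2 inferInstance s hs
  by_cases htop : Submodule.span Lam (Set.range y) = ⊤
  · exact hy.isDiagonalizable htop
  exfalso
  let N : Submodule Lam H := ⨅ i, LinearMap.ker (φ (y i))
  have hmemN (z : H) : z ∈ N ↔ ∀ i, φ (y i) z = 0 := by simp [N]
  have hMN {m z : H} (hm : m ∈ Submodule.span Lam (Set.range y)) (hz : z ∈ N) : φ m z = 0 := by
    induction hm using Submodule.span_induction with
    | mem m hm =>
      obtain ⟨i, rfl⟩ := hm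
      exact (hmemN z).1 hz i
    | zero => simp
    | add m m' _ _ hm hm' => simp [hm, hm']
    | smul c m _ hm => rw [LinearMap.map_smulₛₗ, LinearMap.smul_apply, hm, smul_zero]
  have hNbot : N ≠ ⊥ := by
    intro hN
    refine htop (Submodule.eq_top_iff'.2 fun z => ?_)
    obtain ⟨m, hm, hz⟩ := hy.exists_sub_orth z
    have h0 : z - m ∈ N := (hmemN _).2 hz
    rw [hN, Submodule.mem_bot, sub_eq_zero] at h0
    rwa [h0]
  -- An element of `N` orthogonal to `N` is also orthogonal to the span, hence to their sum `H`.
  have hnd : ∀ x ∈ N, (∀ z ∈ N, φ z x = 0) → x = 0 := by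
    intro x hx hxz
    refine h.nonsingular.injective (LinearMap.ext fun z => ?_)
    obtain ⟨m, hm, hz⟩ := hy.exists_sub_orth z
    have h0 : φ z x = 0 := by
      rw [← sub_add_cancel z m, map_add, LinearMap.add_apply, hxz _ ((hmemN _).2 hz), hMN hm hx,
        add_zero]
    rw [h.hermitian, h0]
    simp
  obtain ⟨z, hzN, d, hbar, hd, hdz, hzz, hzz0⟩ := exists_splitting_element h.hermitian hNbot hnd
    (nonZeroDivisors.ne_zero ha0) (fun x _ => Submodule.mem_annihilator.1 ha x trivial) hadd hsub
  have hnew := hy.snoc h.hermitian hbar hd hdz hzz ((hmemN z).1 hzN)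
  -- The span grows strictly: its old elements pair to zero with `z`, whereas `φ z z ≠ 0`.
  refine hmax _ ⟨_, _, _, hnew, rfl⟩ (lt_of_le_of_ne (Submodule.span_mono ?_) fun heq => ?_)
  · rintro _ ⟨i, rfl⟩
    exact ⟨i.castSucc, by simp⟩
  · refine hzz0 (hMN ?_ hzN)
    rw [heq]
    exact Submodule.subset_span ⟨Fin.last n, by simp⟩

end Blanchfield
end

/-! ### Forms of hermitian matrices are Blanchfield forms; evaluation at real units. -/

noncomputable section

namespace Blanchfield

open LaurentPolynomial (T)
open scoped Matrix

section MatrixForm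

variable {n : Type*} [Fintype n] [DecidableEq n] {A : Matrix n n Lam}

omit [Fintype n] [DecidableEq n] in
theorem vecOm_injective : Function.Injective (vecOm : (n → Lam) →ₗ[Lam] (n → Om)) :=
  fun _ _ h => funext fun i => IsFractionRing.injective Lam Om (congrFun h i)

theorem det_smul_eq_zero (x : Coker A) : A.det • x = 0 := by
  obtain ⟨x, rfl⟩ := Submodule.Quotient.mk_surjective _ x
  rw [← Submodule.Quotient.mk_smul, Submodule.Quotient.mk_eq_zero]
  refine ⟨A.adjugate *ᵥ x, ?_⟩
  rw [Matrix.mulVecLin_apply, Matrix.mulVec_mulVec, Matrix.mul_adjugate, Matrix.smul_mulVec,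
    Matrix.one_mulVec]

omit [Fintype n] [DecidableEq n] in
theorem toOm_transpose_map_barOm (hA : IsHermitianMatrix A) : (toOm A)ᵀ.map barOm = toOm A := by
  ext i j
  have h : bar (A j i) = A i j := congrFun (congrFun hA i) j
  simp [barOm_algebraMap, h]

theorem toOm_inv_transpose_map_barOm (hA : IsHermitianMatrix A) (hdet : A.det ≠ 0) :
    ((toOm A)⁻¹)ᵀ.map barOm = (toOm A)⁻¹ := by
  refine (Matrix.inv_eq_left_inv ?_).symm
  conv_lhs => rw [← toOm_transpose_map_barOm hA, ← Matrix.map_mul, ← Matrix.transpose_mul]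
  rw [toOm_transpose_map_barOm hA, Matrix.mul_nonsing_inv _ (isUnit_det_toOm hdet)]
  simp

theorem barOm_vecForm (hA : IsHermitianMatrix A) (hdet : A.det ≠ 0) (a b : n → Lam) :
    barOm (vecForm A b a) = vecForm A a b := by
  have h1 : (fun i => barOm (vecOm (barVec b) i)) = vecOm b :=
    funext fun i => (barOm_algebraMap _).trans (congrArg _ (bar_bar _))
  have h2 : (fun i => barOm (vecOm a i)) = vecOm (barVec a) :=
    funext fun i => barOm_algebraMap _
  rw [vecForm_apply, vecForm_apply, RingHom.map_dotProduct]
  change (fun i => barOm (vecOm (barVec b) i)) ⬝ᵥ (fun i => barOm (((toOm A)⁻¹ *ᵥ vecOm a) i)) = _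
  have h3 : (fun i => barOm (((toOm A)⁻¹ *ᵥ vecOm a) i)) = vecOm (barVec a) ᵥ* (toOm A)⁻¹ := by
    funext i
    rw [RingHom.map_mulVec, ← Matrix.vecMul_transpose, ← Matrix.transpose_map,
      toOm_inv_transpose_map_barOm hA hdet]
    exact congrArg (fun v => (v ᵥ* (toOm A)⁻¹) i) h2
  rw [h1, h3, dotProduct_comm, ← Matrix.dotProduct_mulVec]

theorem matrixForm_hermitian (hA : IsHermitianMatrix A) (hdet : A.det ≠ 0) (a b : Coker A) :
    matrixForm A hA hdet a b = barQL (matrixForm A hA hdet b a) := by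
  obtain ⟨a, rfl⟩ := Submodule.Quotient.mk_surjective _ a
  obtain ⟨b, rfl⟩ := Submodule.Quotient.mk_surjective _ b
  exact congrArg lamInOm.mkQ (barOm_vecForm hA hdet a b).symm

/-- Pairing the basis vectors with `b` shows that `A⁻¹ b` has entries in `Λ`, so `b` lies in `A Λⁿ`.
-/
theorem matrixForm_injective (hA : IsHermitianMatrix A) (hdet : A.det ≠ 0) :
    Function.Injective (matrixForm A hA hdet) := by
  rw [injective_iff_map_eq_zero]
  intro b hb
  obtain ⟨b, rfl⟩ := Submodule.Quotient.mk_surjective _ b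
  have h (i : n) : ∃ c, algebraMap Lam Om c = ((toOm A)⁻¹ *ᵥ vecOm b) i := by
    have h0 : matrixForm A hA hdet (Submodule.Quotient.mk (Pi.single i 1))
        (Submodule.Quotient.mk b) = 0 := by
      rw [matrixForm_hermitian, hb, LinearMap.zero_apply, map_zero]
    have h1 : vecOm (barVec (Pi.single i 1 : n → Lam)) = Pi.single i 1 := by
      funext j
      change algebraMap Lam Om (bar _) = _
      by_cases h : j = i
      · subst h; simp
      · simp [h]
    rw [matrixForm_mk, h1, single_dotProduct, one_mul, Submodule.Quotient.mk_eq_zero] at h0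
    exact h0
  choose c hc using h
  rw [Submodule.Quotient.mk_eq_zero]
  refine ⟨c, vecOm_injective ?_⟩
  have hc' : vecOm c = (toOm A)⁻¹ *ᵥ vecOm b := funext hc
  rw [Matrix.mulVecLin_apply, vecOm_mulVec, hc', Matrix.mulVec_mulVec,
    Matrix.mul_nonsing_inv _ (isUnit_det_toOm hdet), Matrix.one_mulVec]

/-- Lift the values of `ψ` on the basis to a row `ω` over `Ω`. Since `ψ` kills `A Λⁿ`, the row `c =
ω A` is integral, and `ω = c A⁻¹` exhibits `ψ` as pairing with the conjugate of `c`. -/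
theorem matrixForm_surjective (hA : IsHermitianMatrix A) (hdet : A.det ≠ 0) :
    Function.Surjective (matrixForm A hA hdet) := by
  intro ψ
  have hω (i : n) : ∃ ω : Om, lamInOm.mkQ ω = ψ (Submodule.Quotient.mk (Pi.single i 1)) :=
    Submodule.mkQ_surjective _ _
  choose ω hω using hω
  have hψ (b : n → Lam) : ψ (Submodule.Quotient.mk b) = lamInOm.mkQ (ω ⬝ᵥ vecOm b) := by
    have hb : b = ∑ i, b i • (Pi.single i 1 : n → Lam) := by
      simpa using pi_eq_sum_univ' b
    conv_lhs => rw [hb]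
    rw [← Submodule.mkQ_apply, map_sum, map_sum, dotProduct, map_sum]
    refine Finset.sum_congr rfl fun i _ => ?_
    rw [map_smul, map_smul, Submodule.mkQ_apply, ← hω, ← map_smul, Algebra.smul_def, mul_comm]
    rfl
  have hc (i : n) : ∃ c, algebraMap Lam Om c = (ω ᵥ* toOm A) i := by
    have h0 : lamInOm.mkQ (ω ⬝ᵥ vecOm (A *ᵥ Pi.single i 1)) = 0 := by
      rw [← hψ, ← Matrix.mulVecLin_apply,
        (Submodule.Quotient.mk_eq_zero (LinearMap.range A.mulVecLin)).2 ⟨Pi.single i 1, rfl⟩,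
        map_zero]
    rw [vecOm_mulVec, Matrix.dotProduct_mulVec, Submodule.mkQ_apply,
      Submodule.Quotient.mk_eq_zero] at h0
    obtain ⟨c, hc⟩ := h0
    refine ⟨c, hc.trans ?_⟩
    have h1 : vecOm (Pi.single i 1 : n → Lam) = Pi.single i 1 := by
      funext j
      change algebraMap Lam Om _ = _
      by_cases h : j = i
      · subst h; simp
      · simp [h]
    rw [h1, dotProduct_single, mul_one]
  choose c hc using hc
  refine ⟨Submodule.Quotient.mk (barVec c), Submodule.linearMap_qext _ (LinearMap.ext fun b => ?_)⟩
  change matrixForm A hA hdet (Submodule.Quotient.mk (barVec c)) (Submodule.Quotient.mk b) =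
    ψ (Submodule.Quotient.mk b)
  have hcc : vecOm (barVec (barVec c)) = ω ᵥ* toOm A :=
    funext fun i => (congrArg (algebraMap Lam Om) (bar_bar (c i))).trans (hc i)
  rw [matrixForm_mk, hψ, hcc, ← Matrix.dotProduct_mulVec, Matrix.mulVec_mulVec,
    Matrix.mul_nonsing_inv _ (isUnit_det_toOm hdet), Matrix.one_mulVec]
  rfl

theorem isBlanchfieldForm_matrixForm (hA : IsHermitianMatrix A) (hdet : A.det ≠ 0) :
    IsBlanchfieldForm (matrixForm A hA hdet) where
  finite := inferInstance
  torsion := fun x => ⟨⟨A.det, mem_nonZeroDivisors_of_ne_zero hdet⟩, det_smul_eq_zero x⟩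
  hermitian := matrixForm_hermitian hA hdet
  nonsingular := ⟨matrixForm_injective hA hdet, matrixForm_surjective hA hdet⟩

/-- Evaluation of Laurent polynomials at a unit. -/
def evalAt (u : ℝˣ) : Lam →+* ℝ := LaurentPolynomial.eval₂ (RingHom.id ℝ) u

theorem evalAt_T (u : ℝˣ) (m : ℤ) : evalAt u (T m) = ↑(u ^ m) :=
  LaurentPolynomial.eval₂_T _ _ _

theorem dvd_sub_evalAt (u : ℝˣ) (p : Lam) :
    T 1 - LaurentPolynomial.C (u : ℝ) ∣ p - LaurentPolynomial.C (evalAt u p) := by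
  have hmul (p q : Lam)
      (hp : T 1 - LaurentPolynomial.C (u : ℝ) ∣ p - LaurentPolynomial.C (evalAt u p))
      (hq : T 1 - LaurentPolynomial.C (u : ℝ) ∣ q - LaurentPolynomial.C (evalAt u q)) :
      T 1 - LaurentPolynomial.C (u : ℝ) ∣ p * q - LaurentPolynomial.C (evalAt u (p * q)) := by
    obtain ⟨c, hc⟩ := hp
    obtain ⟨d, hd⟩ := hq
    rw [map_mul, map_mul]
    exact ⟨p * d + LaurentPolynomial.C (evalAt u q) * c, by
      linear_combination p * hd + LaurentPolynomial.C (evalAt u q) * hc⟩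
  have hC (a : ℝ) : T 1 - LaurentPolynomial.C (u : ℝ) ∣
      LaurentPolynomial.C a - LaurentPolynomial.C (evalAt u (LaurentPolynomial.C a)) := by
    rw [evalAt, LaurentPolynomial.eval₂_C, RingHom.id_apply, sub_self]
    exact dvd_zero _
  have hT : T 1 - LaurentPolynomial.C (u : ℝ) ∣ T 1 - LaurentPolynomial.C (evalAt u (T 1)) := by
    rw [evalAt_T, zpow_one]
  have hT' : T 1 - LaurentPolynomial.C (u : ℝ) ∣
      T (-1) - LaurentPolynomial.C (evalAt u (T (-1))) := by
    -- `t⁻¹ - u⁻¹ = -t⁻¹ u⁻¹ (t - u)`.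
    refine ⟨-(T (-1) * LaurentPolynomial.C (u⁻¹ : ℝ)), ?_⟩
    have h1 : (T 1 * T (-1) : Lam) = 1 := by rw [← LaurentPolynomial.T_add]; simp
    have h2 : (LaurentPolynomial.C (u : ℝ) * LaurentPolynomial.C (u⁻¹ : ℝ) : Lam) = 1 := by
      rw [← map_mul, mul_inv_cancel₀ u.ne_zero, map_one]
    rw [evalAt_T, zpow_neg_one, Units.val_inv_eq_inv_val]
    linear_combination LaurentPolynomial.C (u⁻¹ : ℝ) * h1 - T (-1) * h2
  induction p using LaurentPolynomial.induction_on with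
  | h_C a => exact hC a
  | h_add hp hq =>
    rw [map_add, map_add, add_sub_add_comm]
    exact dvd_add hp hq
  | h_C_mul_T n a h =>
    rw [LaurentPolynomial.T_add, ← mul_assoc]
    exact hmul _ _ h hT
  | h_C_mul_T_Z n a h =>
    rw [LaurentPolynomial.T_sub, ← mul_assoc]
    exact hmul _ _ h hT'

/-- The determinant kills the cokernel and is congruent modulo `t - u` to its value at `u`. That
non-zero constant therefore kills `x`. -/
theorem eq_zero_of_sub_smul_eq_zero (u : ℝˣ) (hu : evalAt u A.det ≠ 0) (x : Coker A)
    (hx : (T 1 - LaurentPolynomial.C (u : ℝ) : Lam) • x = 0) : x = 0 := by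
  obtain ⟨c, hc⟩ := dvd_sub_evalAt u A.det
  have h : LaurentPolynomial.C (evalAt u A.det) • x = 0 := by
    rw [← sub_sub_cancel A.det (LaurentPolynomial.C (evalAt u A.det)), hc, sub_smul,
      det_smul_eq_zero, mul_comm, mul_smul, hx, smul_zero, sub_zero]
  rw [← one_smul Lam x, ← map_one LaurentPolynomial.C, ← inv_mul_cancel₀ hu, map_mul, mul_smul, h,
    smul_zero]

end MatrixForm

end Blanchfield
end

/-! ### The matrix `A(t)` of a Seifert matrix and its values at `t = 1` and `t = -1`. -/

noncomputable section

namespace Blanchfield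

open LaurentPolynomial (T)
open scoped Matrix

section Seifert

variable {g : ℕ}

theorem seifert_blocks {V : Matrix (Fin g ⊕ Fin g) (Fin g ⊕ Fin g) ℤ}
    (hV : V - V.transpose = Matrix.fromBlocks 0 1 (-1) 0) :
    ∃ P Q W : Matrix (Fin g) (Fin g) ℤ, Pᵀ = P ∧ Wᵀ = W ∧
      V = Matrix.fromBlocks P Q (Qᵀ - 1) W := by
  rw [← Matrix.fromBlocks_toBlocks V, Matrix.fromBlocks_transpose, sub_eq_add_neg,
    Matrix.fromBlocks_neg, Matrix.fromBlocks_add, Matrix.fromBlocks_inj] at hV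
  obtain ⟨h11, h12, -, h22⟩ := hV
  refine ⟨V.toBlocks₁₁, V.toBlocks₁₂, V.toBlocks₂₂, ?_, ?_, ?_⟩
  · exact (add_neg_eq_zero.1 h11).symm
  · exact (add_neg_eq_zero.1 h22).symm
  · have h : V.toBlocks₂₁ = V.toBlocks₁₂ᵀ - 1 := by
      rw [← Matrix.transpose_one, ← h12, Matrix.transpose_add, Matrix.transpose_neg,
        Matrix.transpose_transpose]
      abel
    rw [← h, Matrix.fromBlocks_toBlocks]

/-- The matrix over a commutative ring that is obtained from the Seifert matrix with blocks
`P`, `Q`, `Qᵗ - 1`, `W` by the specialization `t ↦ s`, `t⁻¹ ↦ s'`. -/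
def seifertSpecialization {R : Type*} [CommRing R] (P Q W : Matrix (Fin g) (Fin g) ℤ) (s s' : R) :
    Matrix (Fin g ⊕ Fin g) (Fin g ⊕ Fin g) R :=
  Matrix.fromBlocks (P.map Int.cast) ((1 - s) • Q.map Int.cast - 1)
    ((1 - s') • Qᵀ.map Int.cast - 1) ((2 - s - s') • W.map Int.cast)

theorem map_seifertSpecialization {R S : Type*} [CommRing R] [CommRing S] (f : R →+* S)
    (P Q W : Matrix (Fin g) (Fin g) ℤ) (s s' : R) :
    (seifertSpecialization P Q W s s').map f = seifertSpecialization P Q W (f s) (f s') := by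
  ext i j
  obtain i | i := i <;> obtain j | j := j <;>
    simp [seifertSpecialization, Matrix.one_apply, apply_ite f, map_ofNat]

theorem transpose_seifertSpecialization {R : Type*} [CommRing R] {P W : Matrix (Fin g) (Fin g) ℤ}
    (hP : Pᵀ = P) (hW : Wᵀ = W) (Q : Matrix (Fin g) (Fin g) ℤ) (s s' : R) :
    (seifertSpecialization P Q W s s')ᵀ = seifertSpecialization P Q W s' s := by
  rw [seifertSpecialization, Matrix.fromBlocks_transpose, seifertSpecialization]
  simp only [Matrix.transpose_sub, Matrix.transpose_smul, ← Matrix.transpose_map, hP, hW,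
    Matrix.transpose_one, Matrix.transpose_transpose, sub_right_comm]

/-- At `t = 1` the blocks are `P, -1, -1, 0`, which is invertible over any ring. The generality in
`R` serves the reduction modulo 2 below. -/
theorem det_seifertSpecialization_one_ne_zero {R : Type*} [CommRing R] [Nontrivial R]
    (P Q W : Matrix (Fin g) (Fin g) ℤ) : (seifertSpecialization P Q W (1 : R) 1).det ≠ 0 := by
  have h : seifertSpecialization P Q W (1 : R) 1 *
      Matrix.fromBlocks 0 (-1) (-1) (-P.map Int.cast) = 1 := by
    rw [seifertSpecialization, Matrix.fromBlocks_multiply, ← Matrix.fromBlocks_one]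
    norm_num
  exact (Matrix.isUnit_det_of_right_inverse h).ne_zero

/-- The determinant is an integer, and it is odd because `-1 = 1` modulo 2 reduces it to the value
at `t = 1`. -/
theorem det_seifertSpecialization_neg_one_ne_zero (P Q W : Matrix (Fin g) (Fin g) ℤ) :
    (seifertSpecialization P Q W (-1 : ℝ) (-1)).det ≠ 0 := by
  have h1 : (seifertSpecialization P Q W (-1 : ℤ) (-1)).det ≠ 0 := by
    intro h
    refine det_seifertSpecialization_one_ne_zero (R := ZMod 2) P Q W ?_
    have h' : (1 : ZMod 2) = Int.castRingHom (ZMod 2) (-1) := by decide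
    conv_lhs => rw [h', ← map_seifertSpecialization, ← RingHom.mapMatrix_apply, ← RingHom.map_det, h]
    rfl
  have h2 : (-1 : ℝ) = Int.castRingHom ℝ (-1) := by simp
  rw [h2, ← map_seifertSpecialization, ← RingHom.mapMatrix_apply, ← RingHom.map_det]
  exact (map_ne_zero_iff _ Int.cast_injective).2 h1

theorem tOm_inv : tOm⁻¹ = algebraMap Lam Om (T (-1)) := by
  refine inv_eq_of_mul_eq_one_right ?_
  rw [tOm, ← map_mul, ← LaurentPolynomial.T_add]
  simp

theorem tOm_ne_zero : tOm ≠ 0 := algebraMap_ne_zero (LaurentPolynomial.isUnit_T 1).ne_zero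

theorem tOm_ne_one : tOm ≠ 1 := by
  intro h
  rw [tOm, ← map_one (algebraMap Lam Om)] at h
  have h1 := congrArg (evalAt (-1)) (IsFractionRing.injective Lam Om h)
  rw [evalAt_T, map_one] at h1
  norm_num at h1

/-- The poles cancel because `(1 - t⁻¹)⁻¹ + (1 - t)⁻¹ = 1` in the block of `P`, and `(1 - t) / (1 -
t⁻¹) = -t` and its conjugate in the off-diagonal blocks. -/
theorem seifertToBlanchfield_fromBlocks {P W : Matrix (Fin g) (Fin g) ℤ}
    (hP : Pᵀ = P) (hW : Wᵀ = W) (Q : Matrix (Fin g) (Fin g) ℤ) :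
    seifertToBlanchfield (Matrix.fromBlocks P Q (Qᵀ - 1) W) =
      seifertSpecialization P Q W tOm tOm⁻¹ := by
  have h0 := tOm_ne_zero
  have h1 : 1 - tOm ≠ 0 := sub_ne_zero.2 tOm_ne_one.symm
  have h2 : 1 - tOm⁻¹ = -(1 - tOm) * tOm⁻¹ := by field_simp; ring
  have h3 : tOm - 1 ≠ 0 := sub_ne_zero.2 tOm_ne_one
  rw [seifertToBlanchfield, seifertSpecialization, Matrix.fromBlocks_map, Matrix.fromBlocks_transpose]
  simp only [Matrix.fromBlocks_multiply, Matrix.fromBlocks_add, zero_mul, mul_zero, add_zero,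
    zero_add, one_mul, mul_one, smul_mul_assoc, mul_smul_comm]
  have hP' (i j) : P j i = P i j := congrFun (congrFun hP i) j
  have hW' (i j) : W j i = W i j := congrFun (congrFun hW i) j
  ext i j
  obtain i | i := i <;> obtain j | j := j
  · simp only [Matrix.fromBlocks_apply₁₁, Matrix.add_apply, Matrix.smul_apply, Matrix.map_apply,
      Matrix.transpose_apply, smul_eq_mul, hP' i j, h2]
    field_simp
    ring
  · by_cases hij : i = j
    · subst hij
      simp [h2]
      field_simp
      ring
    · simp [h2, hij, Ne.symm hij]
      field_simp
      ring
  · by_cases hij : i = j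
    · subst hij
      simp [h2]
      field_simp
      ring
    · simp [h2, hij]
      field_simp
      ring
  · simp only [Matrix.fromBlocks_apply₂₂, Matrix.add_apply, Matrix.smul_apply, Matrix.map_apply,
      Matrix.transpose_apply, smul_eq_mul, hW' i j]
    ring

end Seifert

end Blanchfield
end

theorem proposition4p1 :
    -- every Blanchfield form on which `t + 1` and `t - 1` act invertibly is diagonalizable
    (∀ (H : Type*) [AddCommGroup H] [Module Blanchfield.Lam H] (φ : Blanchfield.Form H),
      Blanchfield.IsBlanchfieldForm φ →
      Function.Bijective
        (fun h : H => (LaurentPolynomial.T 1 + 1 : Blanchfield.Lam) • h) →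
      Function.Bijective
        (fun h : H => (LaurentPolynomial.T 1 - 1 : Blanchfield.Lam) • h) →
      Blanchfield.IsDiagonalizable φ) ∧
    -- the real Blanchfield form of a knot, given by a Seifert matrix `V` of the knot with respect
    -- to a symplectic basis, is a diagonalizable Blanchfield form
    (∀ (g : ℕ) (V : Matrix (Fin g ⊕ Fin g) (Fin g ⊕ Fin g) ℤ),
      V - V.transpose = Matrix.fromBlocks 0 1 (-1) 0 →
      ∃ (A : Matrix (Fin g ⊕ Fin g) (Fin g ⊕ Fin g) Blanchfield.Lam)
        (hA : Blanchfield.IsHermitianMatrix A) (hdet : A.det ≠ 0),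
        Blanchfield.toOm A = Blanchfield.seifertToBlanchfield V ∧
        Blanchfield.IsBlanchfieldForm (Blanchfield.matrixForm A hA hdet) ∧
        Blanchfield.IsDiagonalizable (Blanchfield.matrixForm A hA hdet)) := by
  open Blanchfield LaurentPolynomial in
  constructor
  · intro H _ _ φ hφ hadd hsub
    exact hφ.isDiagonalizable (fun x hx => hadd.injective (hx.trans (smul_zero _).symm))
      (fun x hx => hsub.injective (hx.trans (smul_zero _).symm))
  · intro g V hV
    obtain ⟨P, Q, W, hP, hW, rfl⟩ := seifert_blocks hV
    let A := seifertSpecialization P Q W (T 1 : Lam) (T (-1))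
    have hA : IsHermitianMatrix A := by
      rw [IsHermitianMatrix, transpose_seifertSpecialization hP hW, map_seifertSpecialization,
        bar_T, bar_T, neg_neg]
    have heval (u : ℝˣ) : evalAt u A.det = (seifertSpecialization P Q W (u : ℝ) (u⁻¹ : ℝ)).det := by
      rw [RingHom.map_det, RingHom.mapMatrix_apply, map_seifertSpecialization, evalAt_T, evalAt_T,
        zpow_one, zpow_neg_one, Units.val_inv_eq_inv_val]
    have h1 : evalAt 1 A.det ≠ 0 := by
      rw [heval, Units.val_one, inv_one]
      exact det_seifertSpecialization_one_ne_zero P Q W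
    have h2 : evalAt (-1) A.det ≠ 0 := by
      rw [heval, Units.val_neg, Units.val_one, inv_neg, inv_one]
      exact det_seifertSpecialization_neg_one_ne_zero P Q W
    have hdet : A.det ≠ 0 := fun h => h1 (by rw [h, map_zero])
    have hB := isBlanchfieldForm_matrixForm hA hdet
    refine ⟨A, hA, hdet, ?_, hB, hB.isDiagonalizable (fun x hx => ?_) (fun x hx => ?_)⟩
    · rw [seifertToBlanchfield_fromBlocks hP hW, tOm_inv, tOm]
      exact map_seifertSpecialization _ _ _ _ _ _
    · refine eq_zero_of_sub_smul_eq_zero (-1) h2 x ?_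
      rwa [Units.val_neg, Units.val_one, map_neg, map_one, sub_neg_eq_add]
    · refine eq_zero_of_sub_smul_eq_zero 1 h1 x ?_
      rwa [Units.val_one, map_one]
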